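/- Let $K$ be an algebraically closed field of characteristic $0$, $R=K[X,Y]$, $\mathfrak m=(X,Y)$, let $m,n$ be positive integers, and let $\alpha,\beta\in K$ be primitive $m$-th and $n$-th roots of unity. Let $i,j,t,x$ be positive integers with $i\mid m$, $j\mid n$, $t\mid \frac mi$, $t\mid\frac nj$, $\gcd(x,t)=1$, $1\le x\le t$, and put $$H=H_{i,j,t,x}=\{(\alpha^{ai},\beta^{bj})\mid a,b\in\mathbb Z,\ b\equiv ax \pmod t\},$$ acting on $R$ by $K$-algebra automorphisms $(g_1,g_2)\cdot X=g_1X$, $(g_1,g_2)\cdot Y=g_2Y$. Let $A=A_{i,j,t,x}=R^{H}$ and $\mathfrak n=\mathfrak m\cap A$. Let $\nu$ be a valuation of $K(X,Y)$ of rational rank $1$ which is not discrete and which dominates $R_{\mathfrak m}$. For a subring $B$ of $K(X,Y)$ let $S^B(\nu)=\{\nu(f)\mid 0\ne f\in B\}$. Let $Q_0=X,\ Q_1=Y,\ Q_2,\dots\in R$ be the generating sequence of $\nu$ produced by the standard algorithm (Spivakovsky; Cutkosky--Vinh): with $\gamma_l=\nu(Q_l)$ and $\overline{m_l}=\min\{q\in\mathbb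 Z_{>0}\mid q\gamma_l\in \sum_{k<l}\mathbb Z\gamma_k\}$, one has for every $l\ge 1$ $$Q_{l+1}=Q_l^{\overline{m_l}}-\lambda_l\,Q_0^{c_0}Q_1^{c_1}\cdots Q_{l-1}^{c_{l-1}},$$ where $c_0,\dots,c_{l-1}\in\mathbb N$ (depending on $l$) satisfy $\overline{m_l}\gamma_l=\sum_{k<l}c_k\gamma_k$ and $c_k<\overline{m_k}$ for $1\le k<l$, and $\lambda_l\in K\setminus\{0\}$ is the residue of $Q_l^{\overline{m_l}}/(Q_0^{c_0}\cdots Q_{l-1}^{c_{l-1}})$, i.e. the difference of this quotient and $\lambda_l$ has positive value. Assume that every $Q_l$ is an eigenfunction for $H$, i.e. for every $g\in H$ there is $\lambda_g\in K$ with $g\cdot Q_l=\lambda_gQ_l$. Then $S^{R_{\mathfrak m}}(\nu)$ is finitely generated over the subsemigroup $S^{A_{\mathfrak n}}(\nu)$, i.e. there are finitely many $s_1,\dots,s_k\in S^{R_{\mathfrak m}}(\nu)$ with $S^{R_{\mathfrak m}}(\nu)=\{s_1,\dots,s_k\}+S^{A_{\mathfrak n}}(\nu)$, if and only if there exists $N\in\mathbb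 Z_{>0}$ such that $Q_r\in A$ for all $r\ge N$. Further, if $Q_N\in A$ for some $N\ge1$, then $Q_M\in A$ for all $M\ge N$. -/

import Mathlib

open MvPolynomial
open scoped Pointwise

noncomputable section

namespace DiagQuot

/-- The polynomial ring `R = K[X, Y]`, with `X = X 0` and `Y = X 1`. -/
abbrev Poly (K : Type*) [Field K] := MvPolynomial (Fin 2) K

/-- The rational function field `K(X, Y)`. -/
abbrev RatFun (K : Type*) [Field K] := FractionRing (Poly K)

section Action

variable {K : Type*} [Field K]

/-- The `K`-algebra endomorphism `X ↦ g₁ X`, `Y ↦ g₂ Y` of `K[X, Y]`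
attached to a pair of units `g = (g₁, g₂)`. -/
def act (g : Kˣ × Kˣ) : Poly K →ₐ[K] Poly K :=
  aeval ![C (g.1 : K) * X 0, C (g.2 : K) * X 1]

/-- The group `H_{i,j,t,x} = {(α ^ (a i), β ^ (b j)) | a, b ∈ ℤ, b ≡ a x (mod t)}`. -/
def groupH (α β : Kˣ) (i j t x : ℕ) : Subgroup (Kˣ × Kˣ) where
  carrier := {g | ∃ a b : ℤ, b ≡ a * x [ZMOD t] ∧
    g = (α ^ (a * (i : ℤ)), β ^ (b * (j : ℤ)))}
  mul_mem' := by
    rintro _ _ ⟨a, b, h, rfl⟩ ⟨c, d, h', rfl⟩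
    refine ⟨a + c, b + d, ?_, ?_⟩
    · rw [add_mul]; exact h.add h'
    · simp only [Prod.mk_mul_mk, add_mul, zpow_add]
  one_mem' := ⟨0, 0, by simp, by simp [Prod.one_eq_mk]⟩
  inv_mem' := by
    rintro _ ⟨a, b, h, rfl⟩
    refine ⟨-a, -b, ?_, ?_⟩
    · rw [neg_mul]; exact h.neg
    · simp only [Prod.inv_mk, neg_mul, zpow_neg]

/-- `f` is an eigenfunction of `H`: every `g ∈ H` multiplies `f` by a scalar of `K`. -/
def IsEigenfunction (H : Subgroup (Kˣ × Kˣ)) (f : Poly K) : Prop :=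
  ∀ g ∈ H, ∃ c : K, act g f = C c * f

/-- The ring of invariants `K[X, Y]^H`. -/
def invariants (H : Subgroup (Kˣ × Kˣ)) : Subalgebra K (Poly K) where
  carrier := {f | ∀ g ∈ H, act g f = f}
  mul_mem' := by
    intro a b ha hb g hg
    rw [map_mul, ha g hg, hb g hg]
  add_mem' := by
    intro a b ha hb g hg
    rw [map_add, ha g hg, hb g hg]
  algebraMap_mem' := fun r g _ => (act g).commutes r

end Action

section LocalRings

variable (K : Type*) [Field K]

/-- The maximal ideal `𝔪 = (X, Y)` of `K[X, Y]`. -/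
def maxIdeal : Ideal (Poly K) := Ideal.span {X 0, X 1}

theorem mem_maxIdeal_iff (f : Poly K) : f ∈ maxIdeal K ↔ constantCoeff f = 0 := by
  constructor
  · intro hf
    have h : maxIdeal K ≤ RingHom.ker (constantCoeff : Poly K →+* K) := by
      refine Ideal.span_le.2 ?_
      rintro _ (rfl | rfl) <;> simp [RingHom.mem_ker]
    exact h hf
  · intro hf
    have h := (mem_ideal_span_X_image (x := f) (s := (Set.univ : Set (Fin 2)))).2 (by
      intro d hd
      by_contra hne
      push Not at hne
      have hd0 : d = 0 := by ext k; simpa using hne k (Set.mem_univ k)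
      rw [mem_support_iff, hd0] at hd
      exact hd hf)
    have e : (X '' (Set.univ : Set (Fin 2)) : Set (Poly K)) = {X 0, X 1} := by
      ext p
      simp [Fin.exists_fin_two, eq_comm]
    rw [e] at h
    exact h

instance maxIdeal_isPrime : (maxIdeal K).IsPrime := by
  have e : maxIdeal K = RingHom.ker (constantCoeff : Poly K →+* K) :=
    Ideal.ext fun f => by rw [mem_maxIdeal_iff, RingHom.mem_ker]
  rw [e]
  exact RingHom.ker_isPrime _

variable {K}

/-- For a subalgebra `A` of `K[X, Y]`, the ideal `𝔫 = 𝔪 ∩ A` of `A`. -/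
def restrictedIdeal (A : Subalgebra K (Poly K)) : Ideal A := (maxIdeal K).comap A.val

instance restrictedIdeal_isPrime (A : Subalgebra K (Poly K)) :
    (restrictedIdeal A).IsPrime :=
  Ideal.comap_isPrime A.val (maxIdeal K)

/-- For a subalgebra `A` of `K[X, Y]`, the localization `A_𝔫` at `𝔫 = 𝔪 ∩ A`, realized inside
`K(X, Y)` as the ring of fractions `a / b` with `a, b ∈ A` and `b ∉ 𝔫`. -/
def localRing (A : Subalgebra K (Poly K)) : Subring (RatFun K) where
  carrier := {z | ∃ a b : A, b ∉ restrictedIdeal A ∧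
    z = algebraMap (Poly K) (RatFun K) a / algebraMap (Poly K) (RatFun K) b}
  mul_mem' := by
    rintro _ _ ⟨a, b, hb, rfl⟩ ⟨c, d, hd, rfl⟩
    refine ⟨a * c, b * d, (restrictedIdeal_isPrime A).mul_notMem hb hd, ?_⟩
    rw [MulMemClass.coe_mul, MulMemClass.coe_mul, map_mul, map_mul, div_mul_div_comm]
  one_mem' := ⟨1, 1, (Ideal.ne_top_iff_one _).1 (restrictedIdeal_isPrime A).ne_top, by simp⟩
  zero_mem' := ⟨0, 1, (Ideal.ne_top_iff_one _).1 (restrictedIdeal_isPrime A).ne_top, by simp⟩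
  add_mem' := by
    rintro _ _ ⟨a, b, hb, rfl⟩ ⟨c, d, hd, rfl⟩
    have ne : ∀ b : A, b ∉ restrictedIdeal A → algebraMap (Poly K) (RatFun K) b ≠ 0 := by
      intro b hb h0
      apply hb
      have hb0 : (b : Poly K) = 0 := by
        simpa using h0
      have : b = 0 := Subtype.ext hb0
      rw [this]
      exact zero_mem _
    refine ⟨a * d + b * c, b * d, (restrictedIdeal_isPrime A).mul_notMem hb hd, ?_⟩
    rw [AddMemClass.coe_add, MulMemClass.coe_mul, MulMemClass.coe_mul, MulMemClass.coe_mul,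
      map_add, map_mul, map_mul, map_mul, div_add_div _ _ (ne b hb) (ne d hd)]
  neg_mem' := by
    rintro _ ⟨a, b, hb, rfl⟩
    exact ⟨-a, b, hb, by simp [neg_div]⟩

end LocalRings

section Valuations

variable {K : Type*} [Field K]
variable {Γ : Type*} [AddCommGroup Γ] [LinearOrder Γ] [IsOrderedAddMonoid Γ]

/-- The value group `Φ_ν` of an (additively written) valuation `ν` of `K(X, Y)`. -/
def valueGroup (ν : AddValuation (RatFun K) (WithTop Γ)) : AddSubgroup Γ where
  carrier := {γ | ∃ f : RatFun K, f ≠ 0 ∧ ν f = (γ : WithTop Γ)}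
  add_mem' := by
    rintro a b ⟨f, hf, ha⟩ ⟨g, hg, hb⟩
    exact ⟨f * g, mul_ne_zero hf hg, by rw [ν.map_mul, ha, hb, WithTop.coe_add]⟩
  zero_mem' := ⟨1, one_ne_zero, by rw [ν.map_one, WithTop.coe_zero]⟩
  neg_mem' := by
    rintro a ⟨f, hf, ha⟩
    exact ⟨f⁻¹, inv_ne_zero hf, by rw [ν.map_inv, ha, WithTop.LinearOrderedAddCommGroup.coe_neg]⟩

/-- The rational rank `dim_ℚ (Φ_ν ⊗ ℚ)` of `ν`, i.e. the rank of the abelian group `Φ_ν`,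
equals one. -/
def HasRationalRankOne (ν : AddValuation (RatFun K) (WithTop Γ)) : Prop :=
  Module.rank ℤ (valueGroup ν) = 1

/-- `ν` is discrete: its value group is infinite cyclic. -/
def IsDiscrete (ν : AddValuation (RatFun K) (WithTop Γ)) : Prop :=
  Nonempty (valueGroup ν ≃+ ℤ)

/-- `ν` dominates the local ring `B`: the ring `B` lies in the valuation ring of `ν`, and the
elements of `B` of positive value are exactly those of the maximal ideal (the nonunits) of `B`. -/
def Dominates (ν : AddValuation (RatFun K) (WithTop Γ)) (B : Subring (RatFun K)) : Prop :=
  ∀ z : B, 0 ≤ ν (z : RatFun K) ∧ (0 < ν (z : RatFun K) ↔ z ∈ nonunits B)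

/-- The valuation semigroup `S^B(ν) = {ν(f) | 0 ≠ f ∈ B}`. -/
def valueSemigroup (ν : AddValuation (RatFun K) (WithTop Γ)) (B : Subring (RatFun K)) : Set Γ :=
  {γ | ∃ f ∈ B, f ≠ 0 ∧ ν f = (γ : WithTop Γ)}

/-- `S` is finitely generated over `T`: one has `S = {s₁, …, sₙ} + T` for finitely many elements
`s₁, …, sₙ` of `S`. -/
def FinitelyGeneratedOver (S T : Set Γ) : Prop :=
  ∃ F : Finset Γ, (F : Set Γ) ⊆ S ∧ S = (F : Set Γ) + T

/-- The value `γ_l = ν(Q_l)` (used for nonzero `Q_l` only). -/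
def gam (ν : AddValuation (RatFun K) (WithTop Γ)) (Q : ℕ → Poly K) (l : ℕ) : Γ :=
  (ν (algebraMap (Poly K) (RatFun K) (Q l))).untopD 0

/-- `m̄_l`, the least positive integer `q` with `q γ_l ∈ G(γ_0, …, γ_{l-1})`, the group generated
by `γ_0, …, γ_{l-1}`. -/
def mbar (ν : AddValuation (RatFun K) (WithTop Γ)) (Q : ℕ → Poly K) (l : ℕ) : ℕ :=
  sInf {q : ℕ | 0 < q ∧ q • gam ν Q l ∈ AddSubgroup.closure (gam ν Q '' Set.Iio l)}

/-- `Q_0, Q_1, Q_2, …` is the generating sequence of `ν` in `K[X, Y]` that is produced by the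
standard algorithm (for a valuation with residue field `K`): `Q_0 = X`, `Q_1 = Y`, and for `l ≥ 1`
`Q_{l+1} = Q_l ^ m̄_l - λ Q_0 ^ c_0 Q_1 ^ c_1 ⋯ Q_{l-1} ^ c_{l-1}`, where the `c_k ∈ ℕ` are the
exponents with `m̄_l γ_l = c_0 γ_0 + ⋯ + c_{l-1} γ_{l-1}` and `c_k < m̄_k` for `1 ≤ k < l`, and
`λ ∈ K \ {0}` is the residue of `Q_l ^ m̄_l / (Q_0 ^ c_0 ⋯ Q_{l-1} ^ c_{l-1})` in the residue field of `ν`. -/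
structure IsGeneratingSequence (ν : AddValuation (RatFun K) (WithTop Γ)) (Q : ℕ → Poly K) :
    Prop where
  zero : Q 0 = X 0
  one : Q 1 = X 1
  step : ∀ l : ℕ, 1 ≤ l → ∃ (lam : K) (c : ℕ → ℕ), lam ≠ 0 ∧
    (∀ k, 1 ≤ k → k < l → c k < mbar ν Q k) ∧
    mbar ν Q l • gam ν Q l = ∑ k ∈ Finset.range l, c k • gam ν Q k ∧
    Q (l + 1) = Q l ^ mbar ν Q l - C lam * ∏ k ∈ Finset.range l, Q k ^ c k ∧
    0 < ν (algebraMap (Poly K) (RatFun K) (Q l ^ mbar ν Q l) /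
          algebraMap (Poly K) (RatFun K) (∏ k ∈ Finset.range l, Q k ^ c k) -
        algebraMap (Poly K) (RatFun K) (C lam))

end Valuations

end DiagQuot

end

/-!
Write `γ_l = ν(Q_l)` and `d_l = m̄_1 ⋯ m̄_{l-1}`. Every `Q_l` with `l ≥ 1` is monic of degree `d_l` in
`Y` (`IsGeneratingSequence.isYMonic`), so `g ∈ H` multiplies it by `g_2 ^ d_l`. As `d_l ∣ d_{l+1}`,
invariance of `Q_N` passes to all later `Q_M` (`IsGeneratingSequence.mem_invariants_of_le`).

Call a monomial in `Q_0, …, Q_{L-1}` admissible if the exponent of `Q_k` is less than `m̄_k` for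
`1 ≤ k < L`. By minimality of the `m̄_k`, admissible monomials have distinct values
(`eq_of_sum_gam_eq`); by triangularity in the degree in `Y`, every polynomial is modulo `Q_L` a
`K`-combination of them (`exists_span_add_mul`). In rational rank one the `γ_l` are cofinal in the
value group (`IsGeneratingSequence.exists_lt_gam`), so for `f ≠ 0` some `γ_L` exceeds `ν(f)` and
`ν(f)` is the value of an admissible monomial. Since monomials in the `Q_k` are eigenfunctions, this
monomial is invariant if `f` is (`IsGeneratingSequence.exists_admissible`). Hence `S^{R_𝔪}(ν)` and
`S^{A_𝔫}(ν)` consist of the values of the monomials, respectively of the invariant monomials. In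
particular, as `ν` is not discrete, `m̄_l > 1` infinitely often
(`IsGeneratingSequence.exists_mbar_ne_one`).

If `Q_r ∈ A` for `r ≥ N`, the exponents of `Q_k` with `k < N` can be reduced modulo an exponent of
the finite group `H`, which leaves finitely many generators
(`IsGeneratingSequence.finitelyGeneratedOver`). Conversely, given finitely many generators, choose
`L` with `m̄_L > 1` and all generators in the group `G(γ_0, …, γ_{L-1})`, which does not contain
`γ_L`. Then `γ_L` is the sum of a generator and the value of an invariant monomial; positivity
of the `γ_k` forces this monomial to be `Q_L` (`IsGeneratingSequence.exists_mem_invariants`).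
-/

namespace DiagQuot

/-! ### Polynomials monic in `Y` -/

section Degree

variable {K : Type*} [Field K]

/-- `p` has degree less than `d` in `Y`. A strict bound is used so that `p = 0` needs no
separate treatment. -/
def YDegreeLT (d : ℕ) (p : Poly K) : Prop := ∀ s ∈ p.support, s 1 < d

/-- `p`, as a polynomial in `Y` over `K[X]`, is monic of degree `d`. -/
def IsYMonic (d : ℕ) (p : Poly K) : Prop := YDegreeLT d (p - X 1 ^ d)

theorem YDegreeLT.mono {d e : ℕ} {p : Poly K} (h : YDegreeLT d p) (hde : d ≤ e) :
    YDegreeLT e p := fun s hs => (h s hs).trans_le hde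

theorem YDegreeLT.add {d : ℕ} {p q : Poly K} (hp : YDegreeLT d p) (hq : YDegreeLT d q) :
    YDegreeLT d (p + q) := by
  classical
  intro s hs
  rcases Finset.mem_union.1 (support_add hs) with h | h
  exacts [hp s h, hq s h]

theorem YDegreeLT.neg {d : ℕ} {p : Poly K} (hp : YDegreeLT d p) : YDegreeLT d (-p) := by
  intro s hs
  rw [support_neg] at hs
  exact hp s hs

theorem YDegreeLT.mul {d e : ℕ} {p q : Poly K} (hp : YDegreeLT d p) (hq : YDegreeLT (e + 1) q) :
    YDegreeLT (d + e) (p * q) := by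
  classical
  intro s hs
  obtain ⟨u, hu, v, hv, rfl⟩ := Finset.mem_add.1 (support_mul p q hs)
  have h1 := hp u hu
  have h2 := hq v hv
  rw [Finsupp.add_apply]
  omega

theorem yDegreeLT_Y_pow (d : ℕ) : YDegreeLT (d + 1) (X 1 ^ d : Poly K) := by
  intro s hs
  rw [X_pow_eq_monomial] at hs
  have h := Finset.mem_singleton.1 (support_monomial_subset hs)
  simp [h]

theorem yDegreeLT_X_pow (a : ℕ) : YDegreeLT 1 (X 0 ^ a : Poly K) := by
  intro s hs
  rw [X_pow_eq_monomial] at hs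
  have h := Finset.mem_singleton.1 (support_monomial_subset hs)
  simp [h]

theorem yDegreeLT_C (a : K) : YDegreeLT 1 (C a : Poly K) := by
  intro s hs
  have h := Finset.mem_singleton.1 (support_monomial_subset (s := 0) (a := a) hs)
  simp [h]

theorem isYMonic_Y_pow (d : ℕ) : IsYMonic d (X 1 ^ d : Poly K) := by
  simp [IsYMonic, YDegreeLT]

theorem isYMonic_one : IsYMonic 0 (1 : Poly K) := by
  simp [IsYMonic, YDegreeLT]

theorem IsYMonic.yDegreeLT {d : ℕ} {p : Poly K} (h : IsYMonic d p) : YDegreeLT (d + 1) p := by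
  have := (YDegreeLT.mono h d.le_succ).add (yDegreeLT_Y_pow d)
  rwa [sub_add_cancel] at this

theorem IsYMonic.add {d : ℕ} {p q : Poly K} (hp : IsYMonic d p) (hq : YDegreeLT d q) :
    IsYMonic d (p + q) := by
  have := YDegreeLT.add hp hq
  rwa [sub_add_eq_add_sub] at this

theorem IsYMonic.mul {d e : ℕ} {p q : Poly K} (hp : IsYMonic d p) (hq : IsYMonic e q) :
    IsYMonic (d + e) (p * q) := by
  have h1 : YDegreeLT (d + e) ((p - X 1 ^ d) * q) := YDegreeLT.mul hp hq.yDegreeLT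
  have h2 : YDegreeLT (e + d) ((q - X 1 ^ e) * X 1 ^ d) :=
    YDegreeLT.mul hq (isYMonic_Y_pow d).yDegreeLT
  have h := h1.add (add_comm e d ▸ h2)
  have e1 : (p - X 1 ^ d) * q + (q - X 1 ^ e) * X 1 ^ d = p * q - X 1 ^ (d + e) := by ring
  rwa [e1] at h

theorem IsYMonic.pow {d : ℕ} {p : Poly K} (hp : IsYMonic d p) (k : ℕ) :
    IsYMonic (d * k) (p ^ k) := by
  induction k with
  | zero => simpa using isYMonic_one
  | succ k ih => rw [pow_succ, Nat.mul_succ]; exact ih.mul hp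

theorem IsYMonic.coeff_eq_one {d : ℕ} {p : Poly K} (hp : IsYMonic d p) :
    coeff (Finsupp.single 1 d) p = 1 := by
  have h : coeff (Finsupp.single 1 d) (p - X 1 ^ d) = 0 := by
    by_contra hne
    have := hp _ (mem_support_iff.2 hne)
    simp at this
  rw [coeff_sub, X_pow_eq_monomial, coeff_monomial, if_pos rfl] at h
  exact sub_eq_zero.1 h

theorem IsYMonic.ne_zero {d : ℕ} {p : Poly K} (hp : IsYMonic d p) : p ≠ 0 := by
  rintro rfl
  simpa using hp.coeff_eq_one

/-- Triangularity: a `K[X]`-submodule `T` of `K[X, Y]` that contains a `Y`-monic polynomial of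
every degree is everything. The submodule is given as a `K`-subspace, and `K[X]`-stability is
needed for the monic polynomials only. -/
theorem eq_top_of_isYMonic_mem (T : Submodule K (Poly K))
    (h : ∀ e : ℕ, ∃ p : Poly K, IsYMonic e p ∧ ∀ a : ℕ, X 0 ^ a * p ∈ T) : T = ⊤ := by
  have lt_mem : ∀ e : ℕ, (∀ a, ∀ b < e, (X 0 ^ a * X 1 ^ b : Poly K) ∈ T) →
      ∀ p : Poly K, YDegreeLT e p → p ∈ T := by
    intro e he p hp
    rw [p.as_sum]
    refine T.sum_mem fun s hs => ?_
    have : monomial s (coeff s p) = coeff s p • (X 0 ^ s 0 * X 1 ^ s 1 : Poly K) := by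
      rw [monomial_eq, Finsupp.prod_fintype _ _ (by simp), Fin.prod_univ_two, smul_eq_C_mul]
    rw [this]
    exact T.smul_mem _ (he _ _ (hp s hs))
  have mem : ∀ e a : ℕ, (X 0 ^ a * X 1 ^ e : Poly K) ∈ T := by
    intro e
    induction e using Nat.strong_induction_on with
    | _ e ih =>
      intro a
      obtain ⟨p, hp, hT⟩ := h e
      have h1 : YDegreeLT (e + 0) ((p - X 1 ^ e) * X 0 ^ a) :=
        YDegreeLT.mul hp (yDegreeLT_X_pow a)
      have h2 := lt_mem e (fun a b hb => ih b hb a) _ h1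
      have e1 : (X 0 ^ a * X 1 ^ e : Poly K) = X 0 ^ a * p - (p - X 1 ^ e) * X 0 ^ a := by ring
      rw [e1]
      exact T.sub_mem (hT a) h2
  refine eq_top_iff.2 fun p _ => lt_mem (p.degreeOf 1 + 1) (fun a b _ => mem b a) p ?_
  intro s hs
  exact Nat.lt_succ_of_le (monomial_le_degreeOf 1 hs)

end Degree

/-! ### Admissible monomials in a sequence of polynomials -/

section Monomials

variable {K : Type*} [Field K]

/-- The product `e_1 ⋯ e_{l-1}`; for `e = m̄` this is the degree of `Q_l` in `Y`. -/
def keyDegree (e : ℕ → ℕ) (l : ℕ) : ℕ := ∏ k ∈ Finset.Ico 1 l, e k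

/-- The exponents of the monomials in `Q_0, …, Q_{L-1}` in which `Q_k` has exponent less than
`e_k` for `1 ≤ k < L`; the exponent of `Q_0 = X` is not bounded. -/
def Admissible (e : ℕ → ℕ) (L : ℕ) (c : ℕ → ℕ) : Prop :=
  (∀ k, 1 ≤ k → k < L → c k < e k) ∧ ∀ k, L ≤ k → c k = 0

/-- The monomial `Q_0 ^ c_0 ⋯ Q_{L-1} ^ c_{L-1}`. -/
noncomputable def keyMonomial (Q : ℕ → Poly K) (L : ℕ) (c : ℕ → ℕ) : Poly K :=
  ∏ k ∈ Finset.range L, Q k ^ c k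

variable {e : ℕ → ℕ} {Q : ℕ → Poly K}

theorem keyDegree_one : keyDegree e 1 = 1 := by simp [keyDegree]

theorem keyDegree_succ {l : ℕ} (hl : 1 ≤ l) : keyDegree e (l + 1) = keyDegree e l * e l :=
  Finset.prod_Ico_succ_top hl e

theorem keyDegree_dvd {l l' : ℕ} (h : l ≤ l') : keyDegree e l ∣ keyDegree e l' :=
  Finset.prod_dvd_prod_of_subset _ _ _ (Finset.Ico_subset_Ico_right h)

theorem keyDegree_pos (he : ∀ k, 1 ≤ k → 0 < e k) (l : ℕ) : 0 < keyDegree e l :=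
  Finset.prod_pos fun k hk => he k (Finset.mem_Ico.1 hk).1

theorem keyMonomial_succ (L : ℕ) (c : ℕ → ℕ) :
    keyMonomial Q (L + 1) c = keyMonomial Q L c * Q L ^ c L :=
  Finset.prod_range_succ _ _

theorem keyMonomial_congr {L : ℕ} {c c' : ℕ → ℕ} (h : ∀ k < L, c k = c' k) :
    keyMonomial Q L c = keyMonomial Q L c' :=
  Finset.prod_congr rfl fun k hk => by rw [h k (Finset.mem_range.1 hk)]

/-- A monomial in `Q_0, …, Q_{L-1}` with bounded exponents has smaller degree in `Y` than `Q_L`: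
this is `∑ (e_k - 1) d_k < d_L` for the mixed radix places `d_k = e_1 ⋯ e_{k-1}`. -/
theorem yDegreeLT_keyMonomial (h0 : Q 0 = X 0) {L : ℕ} (hL : 1 ≤ L)
    (hY : ∀ l, 1 ≤ l → l < L → IsYMonic (keyDegree e l) (Q l)) {c : ℕ → ℕ}
    (hc : ∀ k, 1 ≤ k → k < L → c k < e k) :
    YDegreeLT (keyDegree e L) (keyMonomial Q L c) := by
  induction L, hL using Nat.le_induction with
  | base => simpa [keyMonomial, keyDegree_one, h0] using yDegreeLT_X_pow (c 0)
  | succ L hL ih =>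
    rw [keyMonomial_succ, keyDegree_succ hL]
    refine ((ih (fun l h1 h2 => hY l h1 (h2.trans L.lt_succ_self))
      (fun k h1 h2 => hc k h1 (h2.trans L.lt_succ_self))).mul
        ((hY L hL L.lt_succ_self).pow (c L)).yDegreeLT).mono ?_
    have := Nat.mul_le_mul_left (keyDegree e L) (hc L hL L.lt_succ_self)
    rwa [Nat.mul_succ, add_comm] at this

/-- Mixed radix digits: every degree below `d_L` is the degree of a `Y`-monic admissible monomial
of level `L`. -/
theorem exists_admissible_isYMonic {L : ℕ} (hL : 1 ≤ L) (he : ∀ k, 1 ≤ k → 0 < e k)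
    (hY : ∀ l, 1 ≤ l → IsYMonic (keyDegree e l) (Q l)) {d : ℕ} (hd : d < keyDegree e L) :
    ∃ c, Admissible e L c ∧ c 0 = 0 ∧ IsYMonic d (keyMonomial Q L c) := by
  induction L, hL using Nat.le_induction generalizing d with
  | base =>
    rw [keyDegree_one, Nat.lt_one_iff] at hd
    subst hd
    refine ⟨0, ⟨fun k h1 _ => he k h1, fun _ _ => rfl⟩, rfl, ?_⟩
    simpa [keyMonomial] using isYMonic_one
  | succ L hL ih =>
    rw [keyDegree_succ hL] at hd
    obtain ⟨c, ⟨hc1, hc2⟩, hc0, hm⟩ := ih (Nat.mod_lt d (keyDegree_pos he L))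
    refine ⟨Function.update c L (d / keyDegree e L), ⟨fun k h1 h2 => ?_, fun k hk => ?_⟩, ?_, ?_⟩
    · rcases eq_or_ne k L with rfl | hne
      · rw [Function.update_self]
        exact Nat.div_lt_of_lt_mul hd
      · rw [Function.update_of_ne hne]
        exact hc1 k h1 (by omega)
    · rw [Function.update_of_ne (by omega)]
      exact hc2 k (by omega)
    · rwa [Function.update_of_ne (by omega)]
    · rw [keyMonomial_succ, Function.update_self,
        keyMonomial_congr (c' := c) fun k hk => Function.update_of_ne hk.ne _ _]
      have := hm.mul ((hY L hL).pow (d / keyDegree e L))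
      rwa [Nat.mod_add_div] at this

/-- Division by `Q_L`, with a remainder that is a `K`-combination of admissible monomials. -/
theorem exists_span_add_mul (h0 : Q 0 = X 0) {L : ℕ} (hL : 1 ≤ L) (he : ∀ k, 1 ≤ k → 0 < e k)
    (hY : ∀ l, 1 ≤ l → IsYMonic (keyDegree e l) (Q l)) (f : Poly K) :
    ∃ r ∈ Submodule.span K (keyMonomial Q L '' {c | Admissible e L c}), ∃ g,
      f = r + Q L * g := by
  set T : Submodule K (Poly K) := Submodule.span K (keyMonomial Q L '' {c | Admissible e L c}) ⊔
    LinearMap.range (LinearMap.mulLeft K (Q L)) with hT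
  have key : T = ⊤ := by
    refine eq_top_of_isYMonic_mem T fun d => ?_
    rcases lt_or_ge d (keyDegree e L) with hd | hd
    · obtain ⟨c, ⟨hc1, hc2⟩, hc0, hm⟩ := exists_admissible_isYMonic hL he hY hd
      refine ⟨_, hm, fun a => Submodule.mem_sup_left (Submodule.subset_span ?_)⟩
      refine ⟨Function.update c 0 a, ⟨fun k h1 h2 => ?_, fun k hk => ?_⟩, ?_⟩
      · rw [Function.update_of_ne (by omega)]
        exact hc1 k h1 h2
      · rw [Function.update_of_ne (by omega)]
        exact hc2 k hk
      · obtain ⟨L, rfl⟩ := Nat.exists_eq_succ_of_ne_zero (by omega : L ≠ 0)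
        simp [keyMonomial, Finset.prod_range_succ', hc0, h0, mul_comm]
    · refine ⟨Q L * X 1 ^ (d - keyDegree e L), ?_, fun a => Submodule.mem_sup_right ?_⟩
      · have := (hY L hL).mul (isYMonic_Y_pow (K := K) (d - keyDegree e L))
        rwa [Nat.add_sub_cancel' hd] at this
      · exact ⟨X 0 ^ a * X 1 ^ (d - keyDegree e L), by simp only [LinearMap.mulLeft_apply]; ring⟩
  obtain ⟨r, hr, _, ⟨g, rfl⟩, hg⟩ := Submodule.mem_sup.1 (key ▸ Submodule.mem_top : f ∈ T)
  exact ⟨r, hr, g, hg.symm⟩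

end Monomials

/-! ### The diagonal action -/

section Action

variable {K : Type*} [Field K]

theorem act_monomial (g : Kˣ × Kˣ) (s : Fin 2 →₀ ℕ) (a : K) :
    act g (monomial s a) = monomial s ((g.1 : K) ^ s 0 * (g.2 : K) ^ s 1 * a) := by
  rw [act, aeval_monomial, Finsupp.prod_fintype _ _ (by simp), Fin.prod_univ_two, monomial_eq,
    Finsupp.prod_fintype _ _ (by simp), Fin.prod_univ_two]
  simp only [Matrix.cons_val_zero, Matrix.cons_val_one, map_mul, map_pow, algebraMap_eq]
  ring

theorem coeff_act (g : Kˣ × Kˣ) (s : Fin 2 →₀ ℕ) (f : Poly K) :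
    coeff s (act g f) = (g.1 : K) ^ s 0 * (g.2 : K) ^ s 1 * coeff s f := by
  induction f using MvPolynomial.induction_on' with
  | monomial u a =>
    rw [act_monomial, coeff_monomial, coeff_monomial]
    split_ifs with h
    · rw [h]
    · simp
  | add p q hp hq => rw [map_add, coeff_add, coeff_add, hp, hq, mul_add]

/-- The eigenvalue of an eigenfunction is read off from its coefficient at `Y ^ d`. -/
theorem IsEigenfunction.act_eq {H : Subgroup (Kˣ × Kˣ)} {f : Poly K} (hf : IsEigenfunction H f)
    {d : ℕ} (hd : IsYMonic d f) {g : Kˣ × Kˣ} (hg : g ∈ H) :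
    act g f = C ((g.2 : K) ^ d) * f := by
  obtain ⟨c, hc⟩ := hf g hg
  have h := congrArg (coeff (Finsupp.single 1 d)) hc
  rw [coeff_act, coeff_C_mul, hd.coeff_eq_one] at h
  rw [hc, ← mul_one c, ← h]
  simp

theorem IsEigenfunction.pow {H : Subgroup (Kˣ × Kˣ)} {f : Poly K} (hf : IsEigenfunction H f)
    (k : ℕ) : IsEigenfunction H (f ^ k) := by
  intro g hg
  obtain ⟨c, hc⟩ := hf g hg
  exact ⟨c ^ k, by rw [map_pow, hc, mul_pow, map_pow]⟩

theorem IsEigenfunction.mul {H : Subgroup (Kˣ × Kˣ)} {f f' : Poly K} (hf : IsEigenfunction H f)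
    (hf' : IsEigenfunction H f') : IsEigenfunction H (f * f') := by
  intro g hg
  obtain ⟨c, hc⟩ := hf g hg
  obtain ⟨c', hc'⟩ := hf' g hg
  exact ⟨c * c', by rw [map_mul, hc, hc', map_mul]; ring⟩

theorem isEigenfunction_keyMonomial {H : Subgroup (Kˣ × Kˣ)} {Q : ℕ → Poly K}
    (h : ∀ l, IsEigenfunction H (Q l)) (L : ℕ) (c : ℕ → ℕ) :
    IsEigenfunction H (keyMonomial Q L c) := by
  induction L with
  | zero => exact fun g _ => ⟨1, by simp [keyMonomial]⟩
  | succ L ih => rw [keyMonomial_succ]; exact ih.mul ((h L).pow _)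

theorem pow_eq_one_of_mem_groupH {m n : ℕ} {α β : Kˣ} (hα : α ^ m = 1) (hβ : β ^ n = 1)
    {i j t x : ℕ} {g : Kˣ × Kˣ} (hg : g ∈ groupH α β i j t x) : g ^ (m * n) = 1 := by
  obtain ⟨a, b, -, rfl⟩ := hg
  refine Prod.ext ?_ ?_
  · change (α ^ (a * (i : ℤ))) ^ (m * n) = 1
    rw [← zpow_natCast, ← zpow_mul, Nat.cast_mul, mul_comm, mul_assoc, zpow_mul, zpow_natCast, hα,
      one_zpow]
  · change (β ^ (b * (j : ℤ))) ^ (m * n) = 1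
    rw [← zpow_natCast, ← zpow_mul, Nat.cast_mul, mul_comm, mul_comm (m : ℤ), mul_assoc, zpow_mul,
      zpow_natCast, hβ, one_zpow]

end Action

/-! ### Valuations dominating the local ring of the origin -/

section Domination

variable {K : Type*} [Field K]
variable {Γ : Type*} [AddCommGroup Γ] [LinearOrder Γ] [IsOrderedAddMonoid Γ]

/-- The restriction of a valuation of `K(X, Y)` to `K[X, Y]`. -/
noncomputable def polyVal (ν : AddValuation (RatFun K) (WithTop Γ)) :
    AddValuation (Poly K) (WithTop Γ) :=
  ν.comap (algebraMap (Poly K) (RatFun K))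

variable {ν : AddValuation (RatFun K) (WithTop Γ)}

theorem polyVal_apply (f : Poly K) : polyVal ν f = ν (algebraMap (Poly K) (RatFun K) f) := rfl

theorem polyVal_ne_top {f : Poly K} (hf : f ≠ 0) : polyVal ν f ≠ ⊤ := by
  rw [polyVal_apply, AddValuation.ne_top_iff]
  simpa using hf

theorem ne_zero_of_polyVal_eq_coe {f : Poly K} {γ : Γ} (h : polyVal ν f = γ) : f ≠ 0 := by
  rintro rfl
  rw [AddValuation.map_zero] at h
  exact WithTop.top_ne_coe h

theorem exists_polyVal_eq_coe {f : Poly K} (hf : f ≠ 0) : ∃ γ : Γ, polyVal ν f = γ :=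
  (WithTop.ne_top_iff_exists.1 (polyVal_ne_top hf)).imp fun _ h => h.symm

theorem algebraMap_mem_localRing {A : Subalgebra K (Poly K)} {f : Poly K} (hf : f ∈ A) :
    algebraMap (Poly K) (RatFun K) f ∈ localRing A :=
  ⟨⟨f, hf⟩, 1, (Ideal.ne_top_iff_one _).1 (restrictedIdeal_isPrime A).ne_top, by simp⟩

theorem Dominates.polyVal_nonneg (hdom : Dominates ν (localRing (⊤ : Subalgebra K (Poly K))))
    (f : Poly K) : 0 ≤ polyVal ν f :=
  (hdom ⟨_, algebraMap_mem_localRing (A := ⊤) (f := f) trivial⟩).1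

theorem Dominates.polyVal_eq_zero (hdom : Dominates ν (localRing (⊤ : Subalgebra K (Poly K))))
    {f : Poly K} (hf : f ∉ maxIdeal K) : polyVal ν f = 0 := by
  set z : localRing (⊤ : Subalgebra K (Poly K)) :=
    ⟨_, algebraMap_mem_localRing (A := ⊤) (f := f) trivial⟩ with hz
  have hf0 : algebraMap (Poly K) (RatFun K) f ≠ 0 := by
    intro h
    rw [IsFractionRing.to_map_eq_zero_iff] at h
    exact hf (h ▸ zero_mem _)
  have hu : IsUnit z := by
    refine IsUnit.of_mul_eq_one ⟨1 / algebraMap (Poly K) (RatFun K) f, 1, ⟨f, trivial⟩, hf, by simp⟩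
      (Subtype.ext ?_)
    simp [hz, hf0]
  have h := (hdom z).2.not.2 (fun h => h hu)
  exact le_antisymm (not_lt.1 h) (hdom z).1

theorem Dominates.polyVal_pos (hdom : Dominates ν (localRing (⊤ : Subalgebra K (Poly K))))
    {f : Poly K} (hf : f ∈ maxIdeal K) : 0 < polyVal ν f := by
  set z : localRing (⊤ : Subalgebra K (Poly K)) :=
    ⟨_, algebraMap_mem_localRing (A := ⊤) (f := f) trivial⟩ with hz
  refine (hdom z).2.2 fun hu => ?_
  obtain ⟨⟨_, a, b, hb, rfl⟩, hw⟩ := hu.exists_right_inv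
  have hb0 : algebraMap (Poly K) (RatFun K) b ≠ 0 := by
    intro h
    rw [IsFractionRing.to_map_eq_zero_iff] at h
    exact hb (show (b : Poly K) ∈ maxIdeal K from h ▸ zero_mem _)
  have h1 : algebraMap (Poly K) (RatFun K) f *
      (algebraMap (Poly K) (RatFun K) a / algebraMap (Poly K) (RatFun K) b) = 1 :=
    congrArg Subtype.val hw
  rw [mul_div_assoc', div_eq_one_iff_eq hb0, ← map_mul] at h1
  exact hb (show (b : Poly K) ∈ maxIdeal K from
    IsFractionRing.injective (Poly K) (RatFun K) h1 ▸ Ideal.mul_mem_right _ _ hf)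

theorem Dominates.polyVal_smul (hdom : Dominates ν (localRing (⊤ : Subalgebra K (Poly K))))
    {a : K} (ha : a ≠ 0) (f : Poly K) : polyVal ν (a • f) = polyVal ν f := by
  have h : (C a : Poly K) ∉ maxIdeal K := by rwa [mem_maxIdeal_iff, constantCoeff_C]
  rw [smul_eq_C_mul, AddValuation.map_mul, hdom.polyVal_eq_zero h, zero_add]

/-- The denominators of `A_𝔫` have value zero, so `S^{A_𝔫}(ν)` consists of the values of the
elements of `A`. -/
theorem Dominates.mem_valueSemigroup_iff
    (hdom : Dominates ν (localRing (⊤ : Subalgebra K (Poly K)))) (A : Subalgebra K (Poly K))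
    {γ : Γ} : γ ∈ valueSemigroup ν (localRing A) ↔ ∃ f ∈ A, polyVal ν f = γ := by
  constructor
  · rintro ⟨_, ⟨a, b, hb, rfl⟩, -, hγ⟩
    refine ⟨a, a.2, ?_⟩
    have hb' : ν (algebraMap (Poly K) (RatFun K) b) = 0 := hdom.polyVal_eq_zero hb
    rwa [AddValuation.map_div, hb', sub_zero] at hγ
  · rintro ⟨f, hf, hγ⟩
    exact ⟨_, algebraMap_mem_localRing hf, by simpa using ne_zero_of_polyVal_eq_coe hγ, hγ⟩

/-- In rational rank one any two values are commensurable. -/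
theorem HasRationalRankOne.exists_nsmul_mem_zmultiples (hrank : HasRationalRankOne ν) {a b : Γ}
    (ha : a ∈ valueGroup ν) (hb : b ∈ valueGroup ν) (ha0 : a ≠ 0) :
    ∃ N : ℕ, 0 < N ∧ N • b ∈ AddSubgroup.zmultiples a := by
  have hdep : ¬ LinearIndependent ℤ ![(⟨a, ha⟩ : valueGroup ν), ⟨b, hb⟩] := by
    intro h
    have h2 := h.cardinal_lift_le_rank
    rw [hrank] at h2
    simp at h2
  rw [LinearIndependent.pair_iff] at hdep
  push Not at hdep
  obtain ⟨s, t, hst, hne⟩ := hdep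
  have hst' : s • a + t • b = 0 := congrArg Subtype.val hst
  have ht : t ≠ 0 := by
    rintro rfl
    rw [zero_smul, add_zero] at hst'
    exact hne ((smul_eq_zero.1 hst').resolve_right ha0) rfl
  refine ⟨t.natAbs, Int.natAbs_pos.2 ht, ?_⟩
  have h1 : t • b ∈ AddSubgroup.zmultiples a :=
    ⟨-s, by simpa only [neg_smul] using (neg_eq_of_add_eq_zero_right hst')⟩
  rw [← natCast_zsmul]
  rcases Int.natAbs_eq t with h | h
  · rwa [← h]
  · rw [show ((t.natAbs : ℕ) : ℤ) = -t by omega, neg_smul]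
    exact neg_mem h1

/-- In rational rank one the value group is archimedean. -/
theorem HasRationalRankOne.exists_lt_nsmul (hrank : HasRationalRankOne ν) {a b : Γ}
    (ha : a ∈ valueGroup ν) (hb : b ∈ valueGroup ν) (ha0 : 0 < a) : ∃ n : ℕ, b < n • a := by
  obtain ⟨N, hN, z, hz⟩ := hrank.exists_nsmul_mem_zmultiples ha hb ha0.ne'
  refine ⟨z.natAbs + 1, ?_⟩
  rcases le_or_gt b 0 with hb0 | hb0
  · exact hb0.trans_lt (nsmul_pos ha0 (Nat.succ_ne_zero _))
  · calc b ≤ N • b := le_self_nsmul hb0.le hN.ne'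
      _ = z • a := hz.symm
      _ ≤ (z.natAbs : ℤ) • a := zsmul_le_zsmul_left ha0.le Int.le_natAbs
      _ = z.natAbs • a := natCast_zsmul _ _
      _ < (z.natAbs + 1) • a := nsmul_lt_nsmul_left ha0 (Nat.lt_succ_self _)

theorem mem_valueGroup_of_polyVal {f : Poly K} {γ : Γ} (h : polyVal ν f = γ) :
    γ ∈ valueGroup ν :=
  ⟨algebraMap _ _ f, by simpa using ne_zero_of_polyVal_eq_coe h, h⟩

/-- `gam` is a value also when `Q l = 0`, thanks to its default `0`. -/
theorem gam_mem_valueGroup (Q : ℕ → Poly K) (l : ℕ) : gam ν Q l ∈ valueGroup ν := by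
  by_cases h : Q l = 0
  · have : gam ν Q l = 0 := by simp [gam, h]
    rw [this]
    exact zero_mem _
  · obtain ⟨γ, hγ⟩ := exists_polyVal_eq_coe (ν := ν) h
    have : gam ν Q l = γ := by rw [gam, ← polyVal_apply, hγ, WithTop.untopD_coe]
    rw [this]
    exact mem_valueGroup_of_polyVal hγ

theorem polyVal_eq_gam {Q : ℕ → Poly K} {l : ℕ} (h : Q l ≠ 0) :
    polyVal ν (Q l) = ((gam ν Q l : Γ) : WithTop Γ) := by
  obtain ⟨γ, hγ⟩ := exists_polyVal_eq_coe (ν := ν) h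
  rw [gam, ← polyVal_apply, hγ, WithTop.untopD_coe]

end Domination

/-! ### The integers `m̄_l` -/

section Mbar

variable {K : Type*} [Field K]
variable {Γ : Type*} [AddCommGroup Γ] [LinearOrder Γ] [IsOrderedAddMonoid Γ]
variable {ν : AddValuation (RatFun K) (WithTop Γ)} {Q : ℕ → Poly K}

theorem gam_mem_closure {k l : ℕ} (h : k < l) :
    gam ν Q k ∈ AddSubgroup.closure (gam ν Q '' Set.Iio l) :=
  AddSubgroup.subset_closure ⟨k, h, rfl⟩

theorem closure_gam_mono {k l : ℕ} (h : k ≤ l) :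
    AddSubgroup.closure (gam ν Q '' Set.Iio k) ≤ AddSubgroup.closure (gam ν Q '' Set.Iio l) :=
  AddSubgroup.closure_mono (Set.image_mono (Set.Iio_subset_Iio h))

theorem sum_gam_mem_closure (L : ℕ) (c : ℕ → ℕ) :
    ∑ k ∈ Finset.range L, c k • gam ν Q k ∈ AddSubgroup.closure (gam ν Q '' Set.Iio L) :=
  sum_mem fun _ hk => nsmul_mem (gam_mem_closure (Finset.mem_range.1 hk)) _

theorem mbar_spec (hrank : HasRationalRankOne ν) (h0 : gam ν Q 0 ≠ 0) {l : ℕ} (hl : 1 ≤ l) :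
    0 < mbar ν Q l ∧ mbar ν Q l • gam ν Q l ∈ AddSubgroup.closure (gam ν Q '' Set.Iio l) := by
  obtain ⟨N, hN, hz⟩ := hrank.exists_nsmul_mem_zmultiples (gam_mem_valueGroup Q 0)
    (gam_mem_valueGroup Q l) h0
  exact Nat.sInf_mem (s := {q : ℕ | 0 < q ∧ q • gam ν Q l ∈
    AddSubgroup.closure (gam ν Q '' Set.Iio l)})
    ⟨N, hN, AddSubgroup.zmultiples_le_of_mem (gam_mem_closure hl) hz⟩

theorem eq_zero_of_lt_mbar {l q : ℕ} (hq : q < mbar ν Q l)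
    (hmem : q • gam ν Q l ∈ AddSubgroup.closure (gam ν Q '' Set.Iio l)) : q = 0 := by
  by_contra h
  exact Nat.notMem_of_lt_sInf hq ⟨Nat.pos_of_ne_zero h, hmem⟩

/-- Admissible monomials have pairwise distinct values: the topmost exponents agree because
`c_l γ_l` is determined modulo `G(γ_0, …, γ_{l-1})` and `m̄_l` is minimal. -/
theorem eq_of_sum_gam_eq (h0 : gam ν Q 0 ≠ 0) {L : ℕ} {c c' : ℕ → ℕ}
    (hc : ∀ k, 1 ≤ k → k < L → c k < mbar ν Q k) (hc' : ∀ k, 1 ≤ k → k < L → c' k < mbar ν Q k)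
    (h : ∑ k ∈ Finset.range L, c k • gam ν Q k = ∑ k ∈ Finset.range L, c' k • gam ν Q k) :
    ∀ k < L, c k = c' k := by
  have top_le : ∀ (l : ℕ) (c c' : ℕ → ℕ), c l < mbar ν Q l →
      ∑ k ∈ Finset.range (l + 1), c k • gam ν Q k =
        ∑ k ∈ Finset.range (l + 1), c' k • gam ν Q k → c l ≤ c' l := by
    intro l c c' hc h
    by_contra hlt
    push Not at hlt
    rw [Finset.sum_range_succ, Finset.sum_range_succ] at h
    have h1 : (c l - c' l) • gam ν Q l = ∑ k ∈ Finset.range l, c' k • gam ν Q k -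
        ∑ k ∈ Finset.range l, c k • gam ν Q k := by
      rw [sub_nsmul _ hlt.le, ← sub_eq_add_neg, sub_eq_sub_iff_add_eq_add, add_comm, h, add_comm,
        add_comm]
    have := eq_zero_of_lt_mbar (by omega) (h1 ▸ sub_mem (sum_gam_mem_closure l c')
      (sum_gam_mem_closure l c))
    omega
  induction L with
  | zero => intro k hk; omega
  | succ L ih =>
    have hL : c L = c' L := by
      rcases Nat.eq_zero_or_pos L with rfl | hL
      · have h1 : (c 0 : ℤ) • gam ν Q 0 = (c' 0 : ℤ) • gam ν Q 0 := by simpa using h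
        exact_mod_cast smul_left_injective ℤ h0 h1
      · exact le_antisymm (top_le L c c' (hc L hL L.lt_succ_self) h)
          (top_le L c' c (hc' L hL L.lt_succ_self) h.symm)
    rw [Finset.sum_range_succ, Finset.sum_range_succ, hL] at h
    intro k hk
    rcases Nat.lt_succ_iff_lt_or_eq.1 hk with hk | rfl
    · exact ih (fun k h1 h2 => hc k h1 (h2.trans L.lt_succ_self))
        (fun k h1 h2 => hc' k h1 (h2.trans L.lt_succ_self)) (add_right_cancel h) k hk
    · exact hL

/-- If `m̄_l = 1` from some point on, then all `γ_l` lie in a finitely generated group, so they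
have a common denominator with respect to `γ_0`. -/
theorem exists_common_denominator (hrank : HasRationalRankOne ν) (h0 : gam ν Q 0 ≠ 0) {L : ℕ}
    (hL : ∀ l, L ≤ l → mbar ν Q l = 1) :
    ∃ N : ℕ, 0 < N ∧ ∀ l, N • gam ν Q l ∈ AddSubgroup.zmultiples (gam ν Q 0) := by
  have initial : ∀ L : ℕ, ∃ N : ℕ, 0 < N ∧
      ∀ l < L, N • gam ν Q l ∈ AddSubgroup.zmultiples (gam ν Q 0) := by
    intro L
    induction L with
    | zero => exact ⟨1, one_pos, fun l hl => by omega⟩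
    | succ L ih =>
      obtain ⟨N, hN, h⟩ := ih
      obtain ⟨M, hM, hz⟩ := hrank.exists_nsmul_mem_zmultiples (gam_mem_valueGroup Q 0)
        (gam_mem_valueGroup Q L) h0
      refine ⟨M * N, Nat.mul_pos hM hN, fun l hl => ?_⟩
      rcases Nat.lt_succ_iff_lt_or_eq.1 hl with hl | rfl
      · rw [mul_nsmul']
        exact nsmul_mem (h l hl) M
      · rw [mul_nsmul]
        exact nsmul_mem hz N
  obtain ⟨N, hN, h⟩ := initial (L + 1)
  refine ⟨N, hN, fun l => ?_⟩
  induction l using Nat.strong_induction_on with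
  | _ l ih =>
    rcases lt_or_ge l (L + 1) with hl | hl
    · exact h l hl
    · have h1 := (mbar_spec hrank h0 (by omega : 1 ≤ l)).2
      rw [hL l (by omega), one_nsmul] at h1
      have h2 : AddSubgroup.closure (gam ν Q '' Set.Iio l) ≤
          (AddSubgroup.zmultiples (gam ν Q 0)).comap (nsmulAddMonoidHom N) := by
        rw [AddSubgroup.closure_le]
        rintro _ ⟨k, hk, rfl⟩
        exact ih k hk
      exact h2 h1

end Mbar

/-! ### Values of the generating sequence -/

section GeneratingSequence

variable {K : Type*} [Field K]
variable {Γ : Type*} [AddCommGroup Γ] [LinearOrder Γ] [IsOrderedAddMonoid Γ]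
variable {ν : AddValuation (RatFun K) (WithTop Γ)} {Q : ℕ → Poly K}

theorem IsGeneratingSequence.gam_zero_pos (hQ : IsGeneratingSequence ν Q)
    (hdom : Dominates ν (localRing (⊤ : Subalgebra K (Poly K)))) : 0 < gam ν Q 0 := by
  have h := hdom.polyVal_pos (f := Q 0) (hQ.zero ▸ Ideal.subset_span (by simp))
  rw [polyVal_eq_gam (hQ.zero ▸ X_ne_zero 0)] at h
  exact_mod_cast h

theorem IsGeneratingSequence.mbar_pos (hQ : IsGeneratingSequence ν Q)
    (hdom : Dominates ν (localRing (⊤ : Subalgebra K (Poly K)))) (hrank : HasRationalRankOne ν)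
    {l : ℕ} (hl : 1 ≤ l) : 0 < mbar ν Q l :=
  (mbar_spec hrank (hQ.gam_zero_pos hdom).ne' hl).1

theorem IsGeneratingSequence.isYMonic (hQ : IsGeneratingSequence ν Q)
    (hdom : Dominates ν (localRing (⊤ : Subalgebra K (Poly K)))) (hrank : HasRationalRankOne ν)
    {l : ℕ} (hl : 1 ≤ l) : IsYMonic (keyDegree (mbar ν Q) l) (Q l) := by
  induction l using Nat.strong_induction_on with
  | _ l ih =>
    obtain ⟨l, rfl⟩ := Nat.exists_eq_succ_of_ne_zero (by omega : l ≠ 0)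
    rcases Nat.eq_zero_or_pos l with rfl | h1
    · have h := isYMonic_Y_pow (K := K) 1
      rwa [pow_one, ← hQ.one, ← keyDegree_one (e := mbar ν Q)] at h
    · obtain ⟨lam, c, -, hc, -, hstep, -⟩ := hQ.step l h1
      have hlow : YDegreeLT (keyDegree (mbar ν Q) l) (keyMonomial Q l c) :=
        yDegreeLT_keyMonomial hQ.zero h1 (fun k hk hkl => ih k (by omega) hk) hc
      have hlow' := ((hlow.mul (e := 0) (yDegreeLT_C lam)).neg).mono
        (Nat.le_mul_of_pos_right (keyDegree (mbar ν Q) l) (hQ.mbar_pos hdom hrank h1))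
      have h := ((ih l (by omega) h1).pow (mbar ν Q l)).add hlow'
      rwa [← sub_eq_add_neg, mul_comm _ (C lam), keyMonomial, ← hstep, ← keyDegree_succ h1] at h

theorem IsGeneratingSequence.ne_zero (hQ : IsGeneratingSequence ν Q)
    (hdom : Dominates ν (localRing (⊤ : Subalgebra K (Poly K)))) (hrank : HasRationalRankOne ν)
    (l : ℕ) : Q l ≠ 0 := by
  rcases Nat.eq_zero_or_pos l with rfl | hl
  · exact hQ.zero ▸ X_ne_zero 0
  · exact (hQ.isYMonic hdom hrank hl).ne_zero

theorem polyVal_keyMonomial (hne : ∀ l, Q l ≠ 0) (L : ℕ) (c : ℕ → ℕ) :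
    polyVal ν (keyMonomial Q L c) =
      ((∑ k ∈ Finset.range L, c k • gam ν Q k : Γ) : WithTop Γ) := by
  induction L with
  | zero => simp [keyMonomial]
  | succ L ih =>
    rw [keyMonomial_succ, AddValuation.map_mul, ih, AddValuation.map_pow, polyVal_eq_gam (hne L),
      Finset.sum_range_succ, WithTop.coe_add, WithTop.coe_nsmul]

theorem IsGeneratingSequence.mbar_nsmul_gam_lt (hQ : IsGeneratingSequence ν Q)
    (hdom : Dominates ν (localRing (⊤ : Subalgebra K (Poly K)))) (hrank : HasRationalRankOne ν)
    {l : ℕ} (hl : 1 ≤ l) : mbar ν Q l • gam ν Q l < gam ν Q (l + 1) := by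
  have hne := hQ.ne_zero hdom hrank
  obtain ⟨lam, c, -, -, hval, hstep, hpos⟩ := hQ.step l hl
  have hb : polyVal ν (keyMonomial Q l c) = ((mbar ν Q l • gam ν Q l : Γ) : WithTop Γ) := by
    rw [polyVal_keyMonomial hne, hval]
  have hb0 : algebraMap (Poly K) (RatFun K) (keyMonomial Q l c) ≠ 0 := by
    simpa using ne_zero_of_polyVal_eq_coe hb
  have h := polyVal_eq_gam (ν := ν) (hne (l + 1))
  change 0 < ν (algebraMap (Poly K) (RatFun K) (Q l ^ mbar ν Q l) /
    algebraMap (Poly K) (RatFun K) (keyMonomial Q l c) -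
      algebraMap (Poly K) (RatFun K) (C lam)) at hpos
  have e1 : algebraMap (Poly K) (RatFun K) (Q (l + 1)) =
      algebraMap (Poly K) (RatFun K) (keyMonomial Q l c) *
      (algebraMap (Poly K) (RatFun K) (Q l ^ mbar ν Q l) /
        algebraMap (Poly K) (RatFun K) (keyMonomial Q l c) -
        algebraMap (Poly K) (RatFun K) (C lam)) := by
    rw [mul_sub, mul_div_cancel₀ _ hb0, hstep, map_sub, map_mul, mul_comm (algebraMap _ _ (C lam))]
    rfl
  rw [polyVal_apply, e1, AddValuation.map_mul, ← polyVal_apply, hb] at h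
  rw [← WithTop.coe_lt_coe, ← h]
  simpa only [add_zero] using WithTop.add_lt_add_left WithTop.coe_ne_top hpos

theorem IsGeneratingSequence.gam_pos (hQ : IsGeneratingSequence ν Q)
    (hdom : Dominates ν (localRing (⊤ : Subalgebra K (Poly K)))) (hrank : HasRationalRankOne ν)
    (l : ℕ) : 0 < gam ν Q l := by
  rcases Nat.eq_zero_or_pos l with rfl | hl
  · exact hQ.gam_zero_pos hdom
  · induction l, hl using Nat.le_induction with
    | base =>
      have h := hdom.polyVal_pos (f := Q 1) (hQ.one ▸ Ideal.subset_span (by simp))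
      rw [polyVal_eq_gam (hQ.ne_zero hdom hrank 1)] at h
      exact_mod_cast h
    | succ l hl ih => exact (nsmul_nonneg ih.le _).trans_lt (hQ.mbar_nsmul_gam_lt hdom hrank hl)

theorem IsGeneratingSequence.gam_lt_succ (hQ : IsGeneratingSequence ν Q)
    (hdom : Dominates ν (localRing (⊤ : Subalgebra K (Poly K)))) (hrank : HasRationalRankOne ν)
    {l : ℕ} (hl : 1 ≤ l) : gam ν Q l < gam ν Q (l + 1) :=
  (le_self_nsmul (hQ.gam_pos hdom hrank l).le (hQ.mbar_pos hdom hrank hl).ne').trans_lt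
    (hQ.mbar_nsmul_gam_lt hdom hrank hl)

theorem IsGeneratingSequence.gam_lt (hQ : IsGeneratingSequence ν Q)
    (hdom : Dominates ν (localRing (⊤ : Subalgebra K (Poly K)))) (hrank : HasRationalRankOne ν)
    {k l : ℕ} (hk : 1 ≤ k) (hkl : k < l) : gam ν Q k < gam ν Q l := by
  induction l, hkl using Nat.le_induction with
  | base => exact hQ.gam_lt_succ hdom hrank hk
  | succ l hl ih => exact ih.trans (hQ.gam_lt_succ hdom hrank (by omega))

/-- The values `γ_l` are cofinal in the value group. If `m̄_l ≥ 2` infinitely often they double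
infinitely often; otherwise they eventually form a strictly increasing sequence in a cyclic
group. -/
theorem IsGeneratingSequence.exists_lt_gam (hQ : IsGeneratingSequence ν Q)
    (hdom : Dominates ν (localRing (⊤ : Subalgebra K (Poly K)))) (hrank : HasRationalRankOne ν)
    {v : Γ} (hv : v ∈ valueGroup ν) : ∃ l, 1 ≤ l ∧ v < gam ν Q l := by
  have h0 := hQ.gam_zero_pos hdom
  by_cases hcase : ∃ L, ∀ l, L ≤ l → mbar ν Q l = 1
  · obtain ⟨L, hL⟩ := hcase
    obtain ⟨N, hN, hz⟩ := exists_common_denominator hrank h0.ne' hL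
    have growth : ∀ n : ℕ, ∃ l, 1 ≤ l ∧ n • gam ν Q 0 ≤ N • gam ν Q l := by
      intro n
      induction n with
      | zero => exact ⟨1, le_rfl, by
          simpa using nsmul_nonneg (hQ.gam_pos hdom hrank 1).le N⟩
      | succ n ih =>
        obtain ⟨l, hl, hn⟩ := ih
        refine ⟨l + 1, by omega, ?_⟩
        have hlt : N • gam ν Q l < N • gam ν Q (l + 1) :=
          nsmul_lt_nsmul_right hN.ne' (hQ.gam_lt_succ hdom hrank hl)
        have hlt' := hn.trans_lt hlt
        obtain ⟨z, hz⟩ := hz (l + 1)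
        change z • gam ν Q 0 = _ at hz
        rw [← hz, ← natCast_zsmul, zsmul_lt_zsmul_iff_left h0] at hlt'
        rw [← hz, ← natCast_zsmul]
        exact zsmul_le_zsmul_left h0.le (by push_cast; omega)
    obtain ⟨n, hn⟩ := hrank.exists_lt_nsmul (gam_mem_valueGroup Q 0) (nsmul_mem hv N) h0
    obtain ⟨l, hl, hnl⟩ := growth n
    exact ⟨l, hl, lt_of_nsmul_lt_nsmul_right N (hn.trans_le hnl)⟩
  · push Not at hcase
    have growth : ∀ n : ℕ, ∃ l, 1 ≤ l ∧ n • gam ν Q 1 ≤ gam ν Q l := by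
      intro n
      induction n with
      | zero => exact ⟨1, le_rfl, by simpa using (hQ.gam_pos hdom hrank 1).le⟩
      | succ n ih =>
        obtain ⟨l, hl, hn⟩ := ih
        obtain ⟨l', hl', hne⟩ := hcase l
        refine ⟨l' + 1, by omega, ?_⟩
        have hmono : ∀ k, 1 ≤ k → k ≤ l' → gam ν Q k ≤ gam ν Q l' := fun k h1 h2 =>
          h2.eq_or_lt.elim (fun h => h ▸ le_rfl) fun h => (hQ.gam_lt hdom hrank h1 h).le
        have h2 : 2 ≤ mbar ν Q l' := by
          have := hQ.mbar_pos hdom hrank (by omega : 1 ≤ l')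
          omega
        calc (n + 1) • gam ν Q 1 = n • gam ν Q 1 + gam ν Q 1 := succ_nsmul _ _
          _ ≤ gam ν Q l' + gam ν Q l' :=
            add_le_add (hn.trans (hmono l hl hl')) (hmono 1 le_rfl (by omega))
          _ = 2 • gam ν Q l' := (two_nsmul _).symm
          _ ≤ mbar ν Q l' • gam ν Q l' :=
            nsmul_le_nsmul_left (hQ.gam_pos hdom hrank l').le h2
          _ ≤ gam ν Q (l' + 1) := (hQ.mbar_nsmul_gam_lt hdom hrank (by omega)).le
    obtain ⟨n, hn⟩ := hrank.exists_lt_nsmul (gam_mem_valueGroup Q 1) hv (hQ.gam_pos hdom hrank 1)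
    obtain ⟨l, hl, hnl⟩ := growth n
    exact ⟨l, hl, hn.trans_le hnl⟩

/-! ### Values of polynomials and of invariants -/

/-- A `K`-combination of admissible monomials has value at most that of each monomial occurring
in it: their values are distinct, so no cancellation can happen. -/
theorem IsGeneratingSequence.polyVal_linearCombination_le (hQ : IsGeneratingSequence ν Q)
    (hdom : Dominates ν (localRing (⊤ : Subalgebra K (Poly K)))) (hrank : HasRationalRankOne ν)
    {L : ℕ} (S : Finset (ℕ → ℕ)) (hS : ∀ c ∈ S, Admissible (mbar ν Q) L c) (a : (ℕ → ℕ) → K)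
    {c : ℕ → ℕ} (hc : c ∈ S) (hac : a c ≠ 0) :
    polyVal ν (∑ c ∈ S, a c • keyMonomial Q L c) ≤ polyVal ν (keyMonomial Q L c) := by
  classical
  have hne := hQ.ne_zero hdom hrank
  obtain ⟨b, hb, hmin⟩ := Finset.exists_min_image {c ∈ S | a c ≠ 0}
    (fun c => polyVal ν (keyMonomial Q L c)) ⟨c, Finset.mem_filter.2 ⟨hc, hac⟩⟩
  have hbS := (Finset.mem_filter.1 hb).1
  have hab := (Finset.mem_filter.1 hb).2
  have hfin : polyVal ν (keyMonomial Q L b) ≠ ⊤ := by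
    rw [polyVal_keyMonomial hne]
    exact WithTop.coe_ne_top
  have hrest : polyVal ν (a b • keyMonomial Q L b) <
      polyVal ν (∑ c ∈ S.erase b, a c • keyMonomial Q L c) := by
    rw [hdom.polyVal_smul hab]
    refine AddValuation.map_lt_sum _ hfin fun d hd => ?_
    by_cases had : a d = 0
    · rw [had, zero_smul, AddValuation.map_zero]
      exact lt_top_iff_ne_top.2 hfin
    · rw [hdom.polyVal_smul had]
      have hdS := Finset.mem_of_mem_erase hd
      refine lt_of_le_of_ne (hmin d (Finset.mem_filter.2 ⟨hdS, had⟩)) fun heq => ?_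
      rw [polyVal_keyMonomial hne, polyVal_keyMonomial hne, WithTop.coe_inj] at heq
      have hlow := eq_of_sum_gam_eq (hQ.gam_zero_pos hdom).ne' (hS b hbS).1 (hS d hdS).1 heq
      refine Finset.ne_of_mem_erase hd (funext fun k => ?_)
      rcases lt_or_ge k L with hk | hk
      · exact (hlow k hk).symm
      · rw [(hS d hdS).2 k hk, (hS b hbS).2 k hk]
  rw [← Finset.add_sum_erase S _ hbS, AddValuation.map_add_eq_of_lt_left _ hrest,
    hdom.polyVal_smul hab]
  exact hmin c (Finset.mem_filter.2 ⟨hc, hac⟩)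

/-- The value of `f ≠ 0` is the value of an admissible monomial, and this monomial is invariant
under `H` if `f` is. Modulo some `Q_L` with `γ_L > ν(f)`, `f` is a combination of admissible
monomials; if `g ∈ H` did not fix the one of smallest value, it would occur in `g f - f` modulo
`Q_L`, whereas `g f - f = 0`. -/
theorem IsGeneratingSequence.exists_admissible (hQ : IsGeneratingSequence ν Q)
    (hdom : Dominates ν (localRing (⊤ : Subalgebra K (Poly K)))) (hrank : HasRationalRankOne ν)
    {H : Subgroup (Kˣ × Kˣ)} (heig : ∀ l, IsEigenfunction H (Q l)) {f : Poly K} {v : Γ}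
    (hf : polyVal ν f = v) :
    ∃ L c, Admissible (mbar ν Q) L c ∧ v = ∑ k ∈ Finset.range L, c k • gam ν Q k ∧
      (f ∈ invariants H → keyMonomial Q L c ∈ invariants H) := by
  have hne := hQ.ne_zero hdom hrank
  obtain ⟨L, hL, hlt⟩ := hQ.exists_lt_gam hdom hrank (mem_valueGroup_of_polyVal hf)
  have large : ∀ g : Poly K, (v : WithTop Γ) < polyVal ν (Q L * g) := by
    intro g
    rw [AddValuation.map_mul, polyVal_eq_gam (hne L)]
    exact (WithTop.coe_lt_coe.2 hlt).trans_le (le_add_of_nonneg_right (hdom.polyVal_nonneg g))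
  obtain ⟨r, hr, q, hrq⟩ := exists_span_add_mul hQ.zero hL
    (fun k hk => hQ.mbar_pos hdom hrank hk) (fun l hl => hQ.isYMonic hdom hrank hl) f
  obtain ⟨a, ha, rfl⟩ := (Finsupp.mem_span_image_iff_linearCombination K).1 hr
  rw [Finsupp.linearCombination_apply, Finsupp.sum] at hrq
  have hS : ∀ c ∈ a.support, Admissible (mbar ν Q) L c := fun c hc =>
    (Finsupp.mem_supported K a).1 ha hc
  have hr : polyVal ν (∑ c ∈ a.support, a c • keyMonomial Q L c) = v := by
    rw [← sub_eq_of_eq_add hrq, AddValuation.map_sub_eq_of_lt_left _ (hf ▸ large q), hf]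
  obtain ⟨c, hc, hcle⟩ : ∃ c ∈ a.support, polyVal ν (keyMonomial Q L c) ≤ v := by
    by_contra! hgt
    refine (hr ▸ AddValuation.map_lt_sum (polyVal ν) (WithTop.coe_ne_top (a := v))
      fun c hc => ?_).ne' rfl
    rw [hdom.polyVal_smul (Finsupp.mem_support_iff.1 hc)]
    exact hgt c hc
  have hac := Finsupp.mem_support_iff.1 hc
  have hval : polyVal ν (keyMonomial Q L c) = v :=
    le_antisymm hcle (hr ▸ hQ.polyVal_linearCombination_le hdom hrank a.support hS a hc hac)
  refine ⟨L, c, hS c hc, ?_, fun hinv g hg => ?_⟩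
  · rw [polyVal_keyMonomial hne, WithTop.coe_inj] at hval
    exact hval.symm
  · choose χ hχ using fun d : ℕ → ℕ => isEigenfunction_keyMonomial heig L d g hg
    obtain ⟨χL, hχL⟩ := heig L g hg
    by_cases hone : χ c = 1
    · rw [hχ, hone, map_one, one_mul]
    · exfalso
      have h1 : ∑ d ∈ a.support, (a d * (χ d - 1)) • keyMonomial Q L d =
          Q L * (q - C χL * act g q) := by
        have h2 := hinv g hg
        rw [hrq, map_add, map_mul, hχL, map_sum] at h2
        have h3 : ∑ d ∈ a.support, (a d * (χ d - 1)) • keyMonomial Q L d =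
            ∑ d ∈ a.support, act g (a d • keyMonomial Q L d) -
              ∑ d ∈ a.support, a d • keyMonomial Q L d := by
          rw [← Finset.sum_sub_distrib]
          refine Finset.sum_congr rfl fun d _ => ?_
          rw [map_smul, hχ d, ← smul_eq_C_mul, smul_smul, ← sub_smul, mul_sub, mul_one]
        rw [h3]
        linear_combination h2
      have h4 := hQ.polyVal_linearCombination_le hdom hrank a.support hS
        (fun d => a d * (χ d - 1)) hc (mul_ne_zero hac (sub_ne_zero.2 hone))
      rw [h1, hval] at h4
      exact (large _).not_ge h4

theorem IsGeneratingSequence.value_eq_sum (hQ : IsGeneratingSequence ν Q)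
    (hdom : Dominates ν (localRing (⊤ : Subalgebra K (Poly K)))) (hrank : HasRationalRankOne ν)
    {f : Poly K} {v : Γ} (hf : polyVal ν f = v) :
    ∃ (L : ℕ) (c : ℕ → ℕ), v = ∑ k ∈ Finset.range L, c k • gam ν Q k := by
  -- No group is involved here: every polynomial is an eigenfunction of the trivial group.
  obtain ⟨L, c, -, h, -⟩ := hQ.exists_admissible hdom hrank (H := ⊥)
    (fun l g hg => ⟨1, by
      rw [Subgroup.mem_bot.1 hg]
      ext s
      simp [coeff_act]⟩) hf
  exact ⟨L, c, h⟩

/-- If `m̄_l = 1` for all large `l`, then all values have a common denominator with respect to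
`γ_0`, and the value group embeds in `ℤ`. -/
theorem IsGeneratingSequence.exists_mbar_ne_one (hQ : IsGeneratingSequence ν Q)
    (hdom : Dominates ν (localRing (⊤ : Subalgebra K (Poly K)))) (hrank : HasRationalRankOne ν)
    (hdisc : ¬ IsDiscrete ν) (L : ℕ) : ∃ l, L ≤ l ∧ mbar ν Q l ≠ 1 := by
  by_contra! hL
  have h0 := hQ.gam_zero_pos hdom
  obtain ⟨N, hN, hz⟩ := exists_common_denominator hrank h0.ne' hL
  have hpoly : ∀ (f : Poly K) (v : Γ), polyVal ν f = v →
      N • v ∈ AddSubgroup.zmultiples (gam ν Q 0) := by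
    intro f v hf
    obtain ⟨L, c, rfl⟩ := hQ.value_eq_sum hdom hrank hf
    rw [Finset.smul_sum]
    refine sum_mem fun k _ => ?_
    rw [nsmul_left_comm]
    exact nsmul_mem (hz k) _
  have hall : ∀ v : valueGroup ν, N • (v : Γ) ∈ AddSubgroup.zmultiples (gam ν Q 0) := by
    rintro ⟨v, f, hf, hv⟩
    obtain ⟨a, b, hb, rfl⟩ := IsFractionRing.div_surjective (A := Poly K) f
    have hb0 := nonZeroDivisors.ne_zero hb
    have ha0 : a ≠ 0 := by
      rintro rfl
      simp at hf
    obtain ⟨γ, hγ⟩ := exists_polyVal_eq_coe (ν := ν) ha0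
    obtain ⟨δ, hδ⟩ := exists_polyVal_eq_coe (ν := ν) hb0
    rw [AddValuation.map_div, ← polyVal_apply, ← polyVal_apply, hγ, hδ,
      ← WithTop.LinearOrderedAddCommGroup.coe_sub, WithTop.coe_inj] at hv
    subst hv
    rw [nsmul_sub]
    exact sub_mem (hpoly a γ hγ) (hpoly b δ hδ)
  choose z hz using hall
  have hinj := smul_left_injective ℤ h0.ne'
  have hadd : ∀ v w, z (v + w) = z v + z w := by
    intro v w
    refine hinj ?_
    change z (v + w) • gam ν Q 0 = (z v + z w) • gam ν Q 0
    have h1 : ∀ u, z u • gam ν Q 0 = N • (u : Γ) := hz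
    rw [add_smul, h1, h1, h1, AddSubgroup.coe_add, nsmul_add]
  have hcyc : IsAddCyclic (valueGroup ν) := by
    refine isAddCyclic_of_injective (AddMonoidHom.mk' z hadd) fun v w hvw => ?_
    have h1 : N • (v : Γ) = N • (w : Γ) := by
      rw [← hz v, ← hz w]
      exact congrArg (fun t : ℤ => t • gam ν Q 0) hvw
    exact Subtype.ext (nsmul_right_injective hN.ne' h1)
  have hnt : Nontrivial (valueGroup ν) :=
    ⟨⟨⟨_, gam_mem_valueGroup Q 0⟩, 0, fun h => h0.ne' (congrArg Subtype.val h)⟩⟩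
  have hinf : Infinite (valueGroup ν) := inferInstance
  obtain ⟨g, hg⟩ := hcyc.exists_zsmul_surjective
  exact hdisc ⟨(intEquivOfZMultiplesEqTop g
    (eq_top_iff.2 fun v _ => hg v)).symm⟩

end GeneratingSequence

/-! ### Finite generation -/

section FiniteGeneration

variable {K : Type*} [Field K]

/-- The eigenvalue of an eigenfunction is `g_1 ^ a g_2 ^ b` for any monomial `X ^ a Y ^ b` of `f`,
so its order divides every exponent of the group. -/
theorem IsEigenfunction.pow_mem_invariants {H : Subgroup (Kˣ × Kˣ)} {f : Poly K}
    (hf : IsEigenfunction H f) {M : ℕ} (hM : ∀ g ∈ H, g ^ M = 1) : f ^ M ∈ invariants H := by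
  intro g hg
  by_cases hf0 : f = 0
  · rw [map_pow, hf0, map_zero]
  obtain ⟨c, hc⟩ := hf g hg
  obtain ⟨s, hs⟩ := ne_zero_iff.1 hf0
  have h := congrArg (coeff s) hc
  rw [coeff_act, coeff_C_mul] at h
  have h1 : ((g.1 : K)) ^ M = 1 := by
    rw [← Units.val_pow_eq_pow_val, ← Prod.pow_fst, hM g hg, Prod.fst_one, Units.val_one]
  have h2 : ((g.2 : K)) ^ M = 1 := by
    rw [← Units.val_pow_eq_pow_val, ← Prod.pow_snd, hM g hg, Prod.snd_one, Units.val_one]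
  rw [map_pow, hc, ← mul_right_cancel₀ hs h, mul_pow, ← map_pow, mul_pow, pow_right_comm,
    pow_right_comm (g.2 : K), h1, h2, one_pow, one_pow, one_mul, map_one, one_mul]

theorem IsEigenfunction.mem_invariants_iff {H : Subgroup (Kˣ × Kˣ)} {f : Poly K}
    (hf : IsEigenfunction H f) {d : ℕ} (hd : IsYMonic d f) :
    f ∈ invariants H ↔ ∀ g ∈ H, (g.2 : K) ^ d = 1 := by
  refine forall₂_congr fun g hg => ?_
  rw [hf.act_eq hd hg]
  constructor
  · intro h
    exact C_injective _ _ (mul_right_cancel₀ hd.ne_zero (h.trans (by rw [map_one, one_mul])))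
  · intro h
    rw [h, map_one, one_mul]

variable {Γ : Type*} [AddCommGroup Γ] [LinearOrder Γ] [IsOrderedAddMonoid Γ]
variable {ν : AddValuation (RatFun K) (WithTop Γ)} {Q : ℕ → Poly K} {H : Subgroup (Kˣ × Kˣ)}

/-- For `l ≥ 1`, `g` multiplies `Q_l` by `g_2 ^ d_l` with `d_l = m̄_1 ⋯ m̄_{l-1}`, and `d_l`
divides `d_{l+1}`. -/
theorem IsGeneratingSequence.mem_invariants_of_le (hQ : IsGeneratingSequence ν Q)
    (hdom : Dominates ν (localRing (⊤ : Subalgebra K (Poly K)))) (hrank : HasRationalRankOne ν)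
    (heig : ∀ l, IsEigenfunction H (Q l)) {N M : ℕ} (hN : 1 ≤ N) (hNM : N ≤ M)
    (h : Q N ∈ invariants H) : Q M ∈ invariants H := by
  rw [(heig N).mem_invariants_iff (hQ.isYMonic hdom hrank hN)] at h
  rw [(heig M).mem_invariants_iff (hQ.isYMonic hdom hrank (hN.trans hNM))]
  obtain ⟨q, hq⟩ := keyDegree_dvd (e := mbar ν Q) hNM
  intro g hg
  rw [hq, pow_mul, h g hg, one_pow]

/-- If `Q_r` is invariant for `r ≥ N`, then `S^{R_𝔪}(ν)` is generated over `S^{A_𝔫}(ν)` by the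
`∑_{k < N} r_k γ_k` with `r_k < M`, where `M` is an exponent of `H`. -/
theorem IsGeneratingSequence.finitelyGeneratedOver (hQ : IsGeneratingSequence ν Q)
    (hdom : Dominates ν (localRing (⊤ : Subalgebra K (Poly K)))) (hrank : HasRationalRankOne ν)
    (heig : ∀ l, IsEigenfunction H (Q l)) {M : ℕ} (hM0 : 0 < M) (hM : ∀ g ∈ H, g ^ M = 1) {N : ℕ}
    (hN : ∀ r, N ≤ r → Q r ∈ invariants H) :
    FinitelyGeneratedOver (valueSemigroup ν (localRing (⊤ : Subalgebra K (Poly K))))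
      (valueSemigroup ν (localRing (invariants H))) := by
  classical
  have hne := hQ.ne_zero hdom hrank
  let F : (Fin N → Fin M) → Γ := fun r => ∑ k : Fin N, (r k : ℕ) • gam ν Q k
  have hF : ∀ r, ∃ f : Poly K, polyVal ν f = F r := by
    intro r
    refine ⟨keyMonomial Q N fun k => if hk : k < N then r ⟨k, hk⟩ else 0, ?_⟩
    rw [polyVal_keyMonomial hne, Finset.sum_range]
    simp [F]
  refine ⟨Finset.univ.image F, ?_, ?_⟩
  · intro γ hγ
    obtain ⟨r, -, rfl⟩ := Finset.mem_image.1 hγ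
    obtain ⟨f, hf⟩ := hF r
    exact (hdom.mem_valueSemigroup_iff ⊤).2 ⟨f, trivial, hf⟩
  · ext γ
    rw [Set.mem_add, hdom.mem_valueSemigroup_iff]
    constructor
    · rintro ⟨f, -, hf⟩
      obtain ⟨L, c, hc, hγ, -⟩ := hQ.exists_admissible hdom hrank heig hf
      -- Exponents vanish from `L` on, so the level may be raised to at least `N`.
      have hγ' : γ = ∑ k ∈ Finset.range (N + L), c k • gam ν Q k := by
        rw [hγ]
        refine Finset.sum_subset (Finset.range_subset_range.2 (by omega)) fun k _ hk => ?_
        rw [hc.2 k (by simpa using hk), zero_nsmul]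
      let q : ℕ → ℕ := fun k => if k < N then M * (c k / M) else c k
      refine ⟨F fun k => ⟨c k % M, Nat.mod_lt _ hM0⟩, by simp, _,
        (hdom.mem_valueSemigroup_iff _).2 ⟨keyMonomial Q (N + L) q, ?_,
          polyVal_keyMonomial hne _ _⟩, ?_⟩
      · refine prod_mem fun k _ => ?_
        by_cases hk : k < N
        · simp only [q, if_pos hk, pow_mul]
          exact pow_mem ((heig k).pow_mem_invariants hM) _
        · simp only [q, if_neg hk]
          exact pow_mem (hN k (not_lt.1 hk)) _
      · rw [hγ', Finset.sum_range_add, Finset.sum_range_add, ← add_assoc]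
        congr 1
        · simp only [F]
          rw [← Finset.sum_range fun k => (c k % M) • gam ν Q k, ← Finset.sum_add_distrib]
          refine Finset.sum_congr rfl fun k hk => ?_
          simp only [q, if_pos (Finset.mem_range.1 hk)]
          rw [← add_nsmul, Nat.mod_add_div]
        · simp [q]
    · rintro ⟨s, hs, u, hu, rfl⟩
      obtain ⟨r, -, rfl⟩ := Finset.mem_image.1 hs
      obtain ⟨f, hf⟩ := hF r
      obtain ⟨f', -, hf'⟩ := (hdom.mem_valueSemigroup_iff _).1 hu
      exact ⟨f * f', trivial, by rw [AddValuation.map_mul, hf, hf', WithTop.coe_add]⟩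

/-- If `S^{R_𝔪}(ν)` is finitely generated over `S^{A_𝔫}(ν)`, take `L` with `m̄_L > 1` and so large
that all generators lie in `G(γ_0, …, γ_{L-1})`. Writing `γ_L = s + u` with `s` a generator and
`u` the value of an invariant admissible monomial, `Q_L` has to occur in this monomial, since
`γ_L ∉ G(γ_0, …, γ_{L-1})`; by positivity of the values the monomial is `Q_L`. -/
theorem IsGeneratingSequence.exists_mem_invariants (hQ : IsGeneratingSequence ν Q)
    (hdom : Dominates ν (localRing (⊤ : Subalgebra K (Poly K)))) (hrank : HasRationalRankOne ν)
    (hdisc : ¬ IsDiscrete ν) (heig : ∀ l, IsEigenfunction H (Q l))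
    (hfg : FinitelyGeneratedOver (valueSemigroup ν (localRing (⊤ : Subalgebra K (Poly K))))
      (valueSemigroup ν (localRing (invariants H)))) :
    ∃ L, 1 ≤ L ∧ Q L ∈ invariants H := by
  have hne := hQ.ne_zero hdom hrank
  have hpos := hQ.gam_pos hdom hrank
  obtain ⟨F, hFS, hF⟩ := hfg
  have hval : ∀ s ∈ F, ∃ (l : ℕ) (c : ℕ → ℕ), s = ∑ k ∈ Finset.range l, c k • gam ν Q k := by
    intro s hs
    obtain ⟨f, -, hf⟩ := (hdom.mem_valueSemigroup_iff _).1 (hFS hs)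
    exact hQ.value_eq_sum hdom hrank hf
  choose! lev c hc using hval
  obtain ⟨L, hL, hmbar⟩ := hQ.exists_mbar_ne_one hdom hrank hdisc (F.sup lev + 1)
  have hL1 : 1 ≤ L := by omega
  refine ⟨L, hL1, ?_⟩
  have hgam : gam ν Q L ∉ AddSubgroup.closure (gam ν Q '' Set.Iio L) := by
    intro h
    have hlt : 1 < mbar ν Q L := by
      have := hQ.mbar_pos hdom hrank hL1
      omega
    exact one_ne_zero (eq_zero_of_lt_mbar hlt (by rwa [one_nsmul]))
  have hmem : gam ν Q L ∈ (F : Set Γ) + valueSemigroup ν (localRing (invariants H)) := by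
    rw [← hF, hdom.mem_valueSemigroup_iff]
    exact ⟨Q L, trivial, polyVal_eq_gam (hne L)⟩
  obtain ⟨s, hs, u, hu, hsu⟩ := Set.mem_add.1 hmem
  have hsG : s ∈ AddSubgroup.closure (gam ν Q '' Set.Iio L) := by
    have h1 := sum_gam_mem_closure (ν := ν) (Q := Q) (lev s) (c s)
    rw [← hc s hs] at h1
    have h2 : lev s ≤ F.sup lev := Finset.le_sup hs
    exact closure_gam_mono (by omega : lev s ≤ L) h1
  have hs0 : 0 ≤ s := by
    rw [hc s hs]
    exact Finset.sum_nonneg fun k _ => nsmul_nonneg (hpos k).le _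
  obtain ⟨f, hfinv, hf⟩ := (hdom.mem_valueSemigroup_iff _).1 hu
  obtain ⟨L', b, hb, hub, hinv⟩ := hQ.exists_admissible hdom hrank heig hf
  have hmono := hinv hfinv
  have hterm : ∀ k, 0 ≤ b k • gam ν Q k := fun k => nsmul_nonneg (hpos k).le _
  have hule : u ≤ gam ν Q L := by
    rw [← hsu]
    exact le_add_of_nonneg_left hs0
  -- `Q_k` with `k > L` cannot occur in the monomial, because `γ_k > γ_L`.
  have hhigh : ∀ k, L < k → b k = 0 := by
    intro k hk
    by_contra hbk
    have hkL' : k < L' := by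
      by_contra h
      exact hbk (hb.2 k (not_lt.1 h))
    have h1 : gam ν Q k ≤ u := by
      rw [hub]
      exact (le_self_nsmul (hpos k).le hbk).trans
        (Finset.single_le_sum (fun k _ => hterm k) (Finset.mem_range.2 hkL'))
    exact ((hQ.gam_lt hdom hrank hL1 hk).trans_le (h1.trans hule)).false
  have hbL : b L ≠ 0 := by
    intro hbL
    refine hgam (hsu ▸ add_mem hsG (hub ▸ sum_mem fun k _ => ?_))
    rcases lt_trichotomy k L with hk | rfl | hk
    · exact nsmul_mem (gam_mem_closure hk) _
    · rw [hbL, zero_nsmul]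
      exact zero_mem _
    · rw [hhigh k hk, zero_nsmul]
      exact zero_mem _
  have hLL' : L ∈ Finset.range L' := by
    by_contra h
    exact hbL (hb.2 L (by simpa using h))
  have hsplit := Finset.add_sum_erase _ (fun k => b k • gam ν Q k) hLL'
  rw [← hub] at hsplit
  have hrest0 : 0 ≤ ∑ k ∈ (Finset.range L').erase L, b k • gam ν Q k :=
    Finset.sum_nonneg fun k _ => hterm k
  have hbL1 : b L = 1 := by
    have h1 : b L • gam ν Q L ≤ 1 • gam ν Q L := by
      rw [one_nsmul]
      exact (le_add_of_nonneg_right hrest0).trans (hsplit.le.trans hule)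
    have h2 := (nsmul_le_nsmul_iff_left (hpos L)).1 h1
    omega
  have hrest : ∀ k ∈ (Finset.range L').erase L, b k = 0 := by
    have h1 : ∑ k ∈ (Finset.range L').erase L, b k • gam ν Q k = 0 := by
      refine le_antisymm ?_ hrest0
      rw [hbL1, one_nsmul] at hsplit
      rw [← hsplit] at hule
      simpa using hule
    intro k hk
    have h2 := (Finset.sum_eq_zero_iff_of_nonneg fun k _ => hterm k).1 h1 k hk
    exact (smul_eq_zero.1 h2).resolve_right (hpos k).ne'
  have hmonoQ : keyMonomial Q L' b = Q L := by
    rw [keyMonomial, ← Finset.mul_prod_erase _ _ hLL', hbL1, pow_one,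
      Finset.prod_eq_one fun k hk => by rw [hrest k hk, pow_zero], mul_one]
  rwa [hmonoQ] at hmono

end FiniteGeneration

end DiagQuot

theorem proposition4p2 {K : Type*} [Field K] [IsAlgClosed K] [CharZero K]
    {Γ : Type*} [AddCommGroup Γ] [LinearOrder Γ] [IsOrderedAddMonoid Γ]
    (m n : ℕ) (hm : 0 < m) (hn : 0 < n)
    (α β : Kˣ) (hα : IsPrimitiveRoot α m) (hβ : IsPrimitiveRoot β n)
    (i j t x : ℕ) (hi : i ∣ m) (hj : j ∣ n) (hti : t ∣ m / i) (htj : t ∣ n / j)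
    (hxt : Nat.Coprime x t) (hx1 : 1 ≤ x) (hx : x ≤ t)
    (ν : AddValuation (DiagQuot.RatFun K) (WithTop Γ))
    (hrank : DiagQuot.HasRationalRankOne ν) (hdisc : ¬ DiagQuot.IsDiscrete ν)
    (hdom : DiagQuot.Dominates ν (DiagQuot.localRing (⊤ : Subalgebra K (DiagQuot.Poly K))))
    (Q : ℕ → DiagQuot.Poly K) (hQ : DiagQuot.IsGeneratingSequence ν Q)
    (heig : ∀ l, DiagQuot.IsEigenfunction (DiagQuot.groupH α β i j t x) (Q l)) :
    (DiagQuot.FinitelyGeneratedOver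
        (DiagQuot.valueSemigroup ν (DiagQuot.localRing (⊤ : Subalgebra K (DiagQuot.Poly K))))
        (DiagQuot.valueSemigroup ν
          (DiagQuot.localRing (DiagQuot.invariants (DiagQuot.groupH α β i j t x)))) ↔
      ∃ N : ℕ, 0 < N ∧ ∀ r : ℕ, N ≤ r →
        Q r ∈ DiagQuot.invariants (DiagQuot.groupH α β i j t x)) ∧
    (∀ N M : ℕ, 1 ≤ N → N ≤ M →
      Q N ∈ DiagQuot.invariants (DiagQuot.groupH α β i j t x) →
      Q M ∈ DiagQuot.invariants (DiagQuot.groupH α β i j t x)) := by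
  have further : ∀ N M : ℕ, 1 ≤ N → N ≤ M →
      Q N ∈ DiagQuot.invariants (DiagQuot.groupH α β i j t x) →
      Q M ∈ DiagQuot.invariants (DiagQuot.groupH α β i j t x) :=
    fun N M hN hNM h => hQ.mem_invariants_of_le hdom hrank heig hN hNM h
  refine ⟨⟨fun hfg => ?_, ?_⟩, further⟩
  · obtain ⟨L, hL, hinv⟩ := hQ.exists_mem_invariants hdom hrank hdisc heig hfg
    exact ⟨L, hL, fun r hr => further L r hL hr hinv⟩
  · rintro ⟨N, -, hN⟩
    exact hQ.finitelyGeneratedOver hdom hrank heig (Nat.mul_pos hm hn)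
      (fun g hg => DiagQuot.pow_eq_one_of_mem_groupH hα.pow_eq_one hβ.pow_eq_one hg) hN
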